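/- Theorem 6.3. Let $n\ge 1$, let $\mathfrak b$ be a Borel subalgebra of $\mathfrak{sl}(n+1,\mathbb C)$ (a maximal solvable subalgebra), and call an ideal of $\mathfrak b$ ad-nilpotent if $\operatorname{ad}x$ is a nilpotent endomorphism of $\mathfrak{sl}(n+1,\mathbb C)$ for each element $x$ of the ideal. The class of nilpotence of an ad-nilpotent ideal $\mathfrak i$ is the least integer $m\ge 0$ such that $[\cdots[[\mathfrak i,\mathfrak i],\mathfrak i],\dots,\mathfrak i]=0$, where there are $m$ brackets and $m+1$ occurrences of $\mathfrak i$ (so the zero ideal has class $0$, and the nonzero abelian ideals have class $1$). Let $A$ be an integer with $0\le A\le\binom{n+1}{2}$. Then there are ad-nilpotent ideals of $\mathfrak b$ of dimension $A$; the minimal class of nilpotence of such an ideal is $$\min\left\{k\ge 0:\ \binom{n+1}{2}-(n+1)\left\lfloor\frac{n+1}{k+1}\right\rfloor+(k+1)\binom{\lfloor\frac{n+1}{k+1}\rfloor+1}{2}\ \ge\ A\right\},$$ and the maximal class of nilpotence of such an ideal is $$\left\lfloor n+\tfrac32-\tfrac12\sqrt{4n^2+4n+9-8A}\right\rfloor .$$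 -/

import Mathlib

/-- The Lie algebra `sl(n+1, ℂ)` of traceless complex `(n+1) × (n+1)` matrices, of type `A_n`. -/
abbrev SlC (n : ℕ) : Type := LieAlgebra.SpecialLinear.sl (Fin (n + 1)) ℂ

/-- A Borel subalgebra of a Lie algebra: a maximal solvable subalgebra. -/
def IsBorelSubalgebra {L : Type*} [LieRing L] [LieAlgebra ℂ L] (b : LieSubalgebra ℂ L) : Prop :=
  Maximal (fun s : LieSubalgebra ℂ L => LieAlgebra.IsSolvable s) b

/-- An ideal `I` of a subalgebra `b` of `L` is ad-nilpotent if each of its elements `x` is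
ad-nilpotent in `L`, i.e. `ad x` is a nilpotent endomorphism of `L`. -/
def IsAdNilpotentIdeal {L : Type*} [LieRing L] [LieAlgebra ℂ L] {b : LieSubalgebra ℂ L}
    (I : LieIdeal ℂ b) : Prop :=
  ∀ x ∈ I, IsNilpotent (LieAlgebra.ad ℂ L (x : L))

/-- The class of nilpotence of a Lie algebra `N` (used for an ideal, regarded as a Lie algebra): the
least `m` such that the `m`-fold bracketing `[⋯[[N, N], N], ⋯, N]` (with `m` brackets, so `m + 1`
occurrences of `N`) is zero. Thus, for nilpotent `N`, it is `0` exactly if `N = 0`, and at most `1`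
exactly if `N` is abelian. -/
noncomputable def nilpotenceClass (N : Type*) [LieRing N] [LieAlgebra ℂ N] : ℕ :=
  sInf {m : ℕ | LieModule.lowerCentralSeries ℂ N N m = ⊥}

/-- The set of the classes of nilpotence of the ad-nilpotent ideals of `b` of dimension `A`. -/
def nilpotenceClasses {L : Type*} [LieRing L] [LieAlgebra ℂ L]
    (b : LieSubalgebra ℂ L) (A : ℕ) : Set ℕ :=
  {k : ℕ | ∃ I : LieIdeal ℂ b,
    IsAdNilpotentIdeal I ∧ Module.finrank ℂ I = A ∧ nilpotenceClass I = k}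

/-- The number `C(n+1, 2) - (n+1) ⌊(n+1)/(k+1)⌋ + (k+1) C(⌊(n+1)/(k+1)⌋ + 1, 2)`; the division
of natural numbers here is rounded down. -/
def maxDimFormula (n k : ℕ) : ℤ :=
  ((n + 1).choose 2 : ℤ) - ((n + 1 : ℕ) : ℤ) * (((n + 1) / (k + 1) : ℕ) : ℤ)
    + ((k + 1 : ℕ) : ℤ) * (((n + 1) / (k + 1) + 1).choose 2 : ℤ)

/-- A column profile: a monotone function `g` on the naturals with `g j ≤ j`. It encodes the set of
pairs `(i, j)` with `i < g j`, that is, an upper set of positive roots of type `A`. -/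
structure IsColumnProfile (g : ℕ → ℕ) : Prop where
  mono : Monotone g
  le : ∀ j, g j ≤ j

/-- The number of blocks of the decomposition of `{0, …, m - 1}` obtained by repeatedly cutting off
the final segment that starts at the value of `g` at the last point. -/
def blockCount (g : ℕ → ℕ) : ℕ → ℕ
  | 0 => 0
  | m + 1 => blockCount g (min (g m) m) + 1

@[simp] lemma blockCount_zero (g : ℕ → ℕ) : blockCount g 0 = 0 := by
  simp [blockCount]

lemma blockCount_congr {g g' : ℕ → ℕ} (m : ℕ) (h : ∀ j < m, g j = g' j) :
    blockCount g m = blockCount g' m := by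
  induction m using Nat.strong_induction_on with
  | _ m ih =>
    cases m with
    | zero => simp
    | succ a =>
      rw [blockCount, blockCount, h a (by omega)]
      rw [ih _ (by omega) (fun j hj => h j (by omega))]

lemma blockCount_le (g : ℕ → ℕ) (m : ℕ) : blockCount g m ≤ m := by
  induction m using Nat.strong_induction_on with
  | _ m ih =>
    cases m with
    | zero => simp
    | succ a =>
      rw [blockCount]
      have := ih (min (g a) a) (by omega)
      omega

lemma blockCount_eq_self {g : ℕ → ℕ} (m : ℕ) (h : ∀ j < m, g j = j) : blockCount g m = m := by
  induction m with
  | zero => simp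
  | succ a ih => rw [blockCount, h a (by omega), min_self, ih (fun j hj => h j (by omega))]

namespace IsColumnProfile

variable {g g' : ℕ → ℕ}

lemma blockCount_succ (hg : IsColumnProfile g) (m : ℕ) :
    blockCount g (m + 1) = blockCount g (g m) + 1 := by
  rw [blockCount, min_eq_left (hg.le m)]

lemma blockCount_mono (hg : IsColumnProfile g) : Monotone (blockCount g) := by
  intro m m'
  induction m' using Nat.strong_induction_on generalizing m with
  | _ m' ih =>
    intro h
    cases m with
    | zero => simp
    | succ a =>
      obtain ⟨a', rfl⟩ : ∃ a', m' = a' + 1 := ⟨m' - 1, by omega⟩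
      rw [hg.blockCount_succ, hg.blockCount_succ]
      have := ih (g a') (by have := hg.le a'; omega) (hg.mono (show a ≤ a' by omega))
      omega

lemma blockCount_le_of_le (hg : IsColumnProfile g) (hg' : IsColumnProfile g')
    (h : ∀ j, g j ≤ g' j) (m : ℕ) : blockCount g m ≤ blockCount g' m := by
  induction m using Nat.strong_induction_on with
  | _ m ih =>
    cases m with
    | zero => simp
    | succ a =>
      rw [hg.blockCount_succ, hg'.blockCount_succ]
      have h1 := hg.blockCount_mono (h a)
      have h2 := ih (g' a) (by have := hg'.le a; omega)
      omega

/-- The level `blockCount g (g j)` increases strictly along the pairs encoded by `g`. -/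
lemma level_lt (hg : IsColumnProfile g) {i j : ℕ} (h : i < g j) :
    blockCount g (g i) < blockCount g (g j) := by
  have := hg.blockCount_mono (show i + 1 ≤ g j from h)
  rw [hg.blockCount_succ] at this
  omega

lemma sum_const_le (hg : IsColumnProfile g) {c y : ℕ} (h : c ≤ g y) (s : ℕ) :
    s * c ≤ ∑ b ∈ Finset.Ico y (y + s), g b := by
  have := Finset.card_nsmul_le_sum (Finset.Ico y (y + s)) g c (fun b hb =>
    h.trans (hg.mono (Finset.mem_Ico.1 hb).1))
  simpa using this

/-- A Turán-type bound for the number of pairs encoded by a profile. -/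
lemma two_mul_sum_le (hg : IsColumnProfile g) (q : ℤ) (m : ℕ) :
    2 * ∑ j ∈ Finset.range m, (g j : ℤ)
      ≤ (m : ℤ) ^ 2 - (2 * q + 1) * m + blockCount g m * (q * (q + 1)) := by
  induction m using Nat.strong_induction_on with
  | _ m ih =>
    cases m with
    | zero => simp
    | succ a =>
      have hle := hg.le a
      have h1 := ih (g a) (by omega)
      rw [hg.blockCount_succ]
      rw [← Finset.sum_range_add_sum_Ico _ (show g a ≤ a + 1 by omega)]
      have h2 : ∑ j ∈ Finset.Ico (g a) (a + 1), (g j : ℤ) ≤ ((a + 1 - g a : ℕ) : ℤ) * g a := by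
        have := Finset.sum_le_card_nsmul (Finset.Ico (g a) (a + 1)) (fun j => (g j : ℤ)) (g a)
          (fun j hj => by
            have := hg.mono (show j ≤ a by have := (Finset.mem_Ico.1 hj).2; omega)
            exact_mod_cast this)
        simpa using this
      obtain ⟨s, hs⟩ : ∃ s, a + 1 = g a + s := ⟨a + 1 - g a, by omega⟩
      have hs' : a + 1 - g a = s := by omega
      rw [hs'] at h2
      have h3 : ((a + 1 : ℕ) : ℤ) = g a + s := by exact_mod_cast hs
      rw [h3]
      push_cast
      have h4 : 0 ≤ ((s : ℤ) - q) * (s - q - 1) := by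
        rcases le_or_gt (s : ℤ) q with h | h
        · nlinarith
        · exact mul_nonneg (by omega) (by omega)
      nlinarith

/-- A lower bound for the number of pairs encoded by a profile of given level. -/
lemma le_two_mul_sum (hg : IsColumnProfile g) (y : ℕ) :
    2 * ((y : ℤ) + 1) * blockCount g (g y) - 2 * y
        - blockCount g (g y) * (blockCount g (g y) - 1)
      ≤ 2 * ∑ j ∈ Finset.range (y + 1), (g j : ℤ) := by
  induction y using Nat.strong_induction_on with
  | _ y ih =>
    rcases Nat.eq_zero_or_pos (g y) with h0 | h0
    · rw [h0]
      have : 0 ≤ ∑ j ∈ Finset.range (y + 1), (g j : ℤ) := by positivity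
      simp
      omega
    · obtain ⟨z, hz⟩ : ∃ z, g y = z + 1 := ⟨g y - 1, by omega⟩
      have hle := hg.le y
      have h1 := ih z (by omega)
      obtain ⟨s, hs⟩ : ∃ s, y = z + 1 + s := ⟨y - (z + 1), by omega⟩
      have h2 := hg.sum_const_le ((blockCount_le g (g z)).trans
        (hg.mono (show z ≤ z + 1 by omega))) s
      rw [← hs] at h2
      rw [Finset.sum_range_succ, ← Finset.sum_range_add_sum_Ico _ (show z + 1 ≤ y by omega), hz,
        hg.blockCount_succ]
      have h3 : (s * blockCount g (g z) : ℤ) ≤ ∑ b ∈ Finset.Ico (z + 1) y, (g b : ℤ) := by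
        exact_mod_cast h2
      have h4 : (y : ℤ) = z + 1 + s := by exact_mod_cast hs
      rw [h4]
      push_cast
      nlinarith

lemma exists_sum_succ (hg : IsColumnProfile g) (N : ℕ)
    (h : ∑ j ∈ Finset.range N, g j < ∑ j ∈ Finset.range N, j) :
    ∃ g', IsColumnProfile g' ∧ (∀ j, g j ≤ g' j) ∧
      ∑ j ∈ Finset.range N, g' j = ∑ j ∈ Finset.range N, g j + 1 := by
  obtain ⟨k, hk, hmax⟩ : ∃ k, (k < N ∧ g k < k) ∧ ∀ j, k < j → j < N → g j = j := by
    obtain ⟨j, hj, hlt⟩ := Finset.exists_lt_of_sum_lt h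
    have hne : ((Finset.range N).filter (fun j => g j < j)).Nonempty :=
      ⟨j, Finset.mem_filter.2 ⟨hj, hlt⟩⟩
    refine ⟨_, by simpa only [Finset.mem_filter, Finset.mem_range] using Finset.max'_mem _ hne,
      fun i hi hiN => ?_⟩
    by_contra hne'
    have := Finset.le_max' ((Finset.range N).filter (fun j => g j < j)) i (Finset.mem_filter.2
      ⟨Finset.mem_range.2 hiN, lt_of_le_of_ne (hg.le i) hne'⟩)
    omega
  refine ⟨fun i => if i < k then g i else if i = k then g k + 1 else i,
    ⟨?_, ?_⟩, ?_, ?_⟩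
  · intro a b hab
    have h1 := hg.mono hab
    have h2 := hg.le a
    have h3 := hg.le b
    dsimp only
    split_ifs <;> first | omega | (subst_vars; omega)
  · intro j
    have := hg.le j
    split_ifs <;> omega
  · intro j
    have := hg.le j
    dsimp only
    split_ifs <;> first | omega | (subst_vars; omega)
  · have hk' := Finset.mem_range.2 hk.1
    rw [← Finset.add_sum_erase _ _ hk', ← Finset.add_sum_erase _ g hk']
    simp only [lt_irrefl, if_true, if_false]
    rw [add_right_comm, add_left_inj, add_right_inj]
    refine Finset.sum_congr rfl fun i hi => ?_
    have hi' := Finset.mem_erase.1 hi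
    have hiN := Finset.mem_range.1 hi'.2
    split_ifs with h1 h2
    · rfl
    · exact absurd h2 hi'.1
    · exact (hmax i (by omega) hiN).symm

lemma exists_le_of_sum_le (hg : IsColumnProfile g) (N A : ℕ)
    (h : ∑ j ∈ Finset.range N, g j ≤ A) (hA : A ≤ ∑ j ∈ Finset.range N, j) :
    ∃ g', IsColumnProfile g' ∧ (∀ j, g j ≤ g' j) ∧ ∑ j ∈ Finset.range N, g' j = A := by
  induction A, h using Nat.le_induction with
  | base => exact ⟨g, hg, fun _ => le_rfl, rfl⟩
  | succ B hB ih =>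
    obtain ⟨g₁, hg₁, hle, hs⟩ := ih (by omega)
    obtain ⟨g₂, hg₂, hle₂, hs₂⟩ := hg₁.exists_sum_succ N (by omega)
    exact ⟨g₂, hg₂, fun j => (hle j).trans (hle₂ j), by omega⟩

lemma exists_sum_pred (hg : IsColumnProfile g) (N : ℕ) (h : 0 < ∑ j ∈ Finset.range N, g j) :
    ∃ g', IsColumnProfile g' ∧ (∀ j, g' j ≤ g j) ∧
      ∑ j ∈ Finset.range N, g' j + 1 = ∑ j ∈ Finset.range N, g j := by
  obtain ⟨k, ⟨hkN, hk⟩, hmin⟩ : ∃ k, (k < N ∧ 0 < g k) ∧ ∀ j < k, g j = 0 := by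
    classical
    have hex : ∃ k, k < N ∧ 0 < g k := by
      obtain ⟨j, hj, hne⟩ := Finset.exists_ne_zero_of_sum_ne_zero h.ne'
      exact ⟨j, Finset.mem_range.1 hj, by omega⟩
    refine ⟨_, Nat.find_spec hex, fun j hj => ?_⟩
    by_contra hne
    exact Nat.find_min hex hj ⟨hj.trans (Nat.find_spec hex).1, by omega⟩
  refine ⟨fun i => if i = k then g k - 1 else g i, ⟨fun a b hab => ?_, fun j => ?_⟩,
    fun j => ?_, ?_⟩
  · have h1 := hg.mono hab
    have h2 := hmin a
    split_ifs <;> first | omega | (subst_vars; omega)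
  · have := hg.le j
    split_ifs <;> first | omega | (subst_vars; omega)
  · dsimp only
    split_ifs <;> first | omega | (subst_vars; omega)
  · have hk' := Finset.mem_range.2 hkN
    rw [← Finset.add_sum_erase _ _ hk', ← Finset.add_sum_erase _ g hk', if_pos rfl,
      Finset.sum_congr rfl (fun i hi => if_neg (Finset.ne_of_mem_erase hi)),
      add_right_comm, Nat.sub_add_cancel hk]

lemma exists_le_of_le_sum (hg : IsColumnProfile g) (N A : ℕ)
    (h : A ≤ ∑ j ∈ Finset.range N, g j) :
    ∃ g', IsColumnProfile g' ∧ (∀ j, g' j ≤ g j) ∧ ∑ j ∈ Finset.range N, g' j = A := by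
  obtain ⟨d, hd⟩ := Nat.exists_eq_add_of_le h
  induction d generalizing A with
  | zero => exact ⟨g, hg, fun _ => le_rfl, hd⟩
  | succ d ih =>
    obtain ⟨g₁, hg₁, hle, hs⟩ := ih (A + 1) (by omega) (by omega)
    obtain ⟨g₂, hg₂, hle₂, hs₂⟩ := hg₁.exists_sum_pred N (by omega)
    exact ⟨g₂, hg₂, fun j => (hle₂ j).trans (hle j), by omega⟩

end IsColumnProfile

lemma isColumnProfile_zero : IsColumnProfile fun _ => 0 :=
  ⟨monotone_const, fun _ => Nat.zero_le _⟩

/-- A profile of a decomposition into `p` blocks of sizes `q` and `q + 1`. -/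
lemma exists_balanced_profile (q p N : ℕ) (h₁ : p * q ≤ N) (h₂ : N ≤ p * (q + 1)) :
    ∃ g, IsColumnProfile g ∧ blockCount g N ≤ p ∧
      2 * ∑ j ∈ Finset.range N, (g j : ℤ)
        = (N : ℤ) ^ 2 - (2 * q + 1) * N + p * (q * (q + 1)) := by
  induction p generalizing N with
  | zero =>
    obtain rfl : N = 0 := by omega
    exact ⟨_, isColumnProfile_zero, by simp, by simp⟩
  | succ p ih =>
    rw [add_mul, one_mul] at h₁ h₂
    obtain ⟨s, M, hN, hs, hM₁, hM₂⟩ : ∃ s M, N = M + s ∧ (s = q ∨ s = q + 1) ∧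
        p * q ≤ M ∧ M ≤ p * (q + 1) := by
      rcases Nat.lt_or_ge N (p * q + q + 1) with h | h
      · refine ⟨q, p * q, by omega, Or.inl rfl, le_rfl, ?_⟩
        gcongr
        omega
      · exact ⟨q + 1, N - (q + 1), by omega, Or.inr rfl, by omega, by omega⟩
    obtain ⟨g, hg, hc, hsum⟩ := ih M hM₁ hM₂
    have hprof : IsColumnProfile fun j => if j < M then g j else M := by
      refine ⟨fun a b hab => ?_, fun j => ?_⟩
      · have h1 := hg.mono hab
        have h2 := hg.le a
        try dsimp only
        split_ifs <;> omega
      · have := hg.le j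
        split_ifs <;> omega
    refine ⟨_, hprof, ?_, ?_⟩
    · have hM : blockCount (fun j => if j < M then g j else M) M = blockCount g M :=
        blockCount_congr M fun j hj => if_pos hj
      rcases Nat.eq_zero_or_pos s with h0 | h0
      · rw [hN, h0, add_zero, hM]
        omega
      · obtain ⟨a, rfl⟩ : ∃ a, s = a + 1 := ⟨s - 1, by omega⟩
        rw [hN, ← add_assoc, hprof.blockCount_succ, if_neg (by omega), hM]
        omega
    · rw [hN, Finset.sum_range_add]
      have e1 : ∑ x ∈ Finset.range M, (((if x < M then g x else M : ℕ)) : ℤ)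
          = ∑ x ∈ Finset.range M, (g x : ℤ) :=
        Finset.sum_congr rfl fun i hi => by rw [if_pos (Finset.mem_range.1 hi)]
      have e2 : ∑ x ∈ Finset.range s, (((if M + x < M then g (M + x) else M : ℕ)) : ℤ)
          = s * M := by simp
      rw [e1, e2, mul_add, hsum]
      push_cast
      rcases hs with rfl | rfl <;> push_cast <;> ring

lemma two_mul_sum_min (k n : ℕ) (h : k ≤ n) :
    2 * ∑ j ∈ Finset.range n, ((min j k : ℕ) : ℤ) = k * (2 * n - k - 1) := by
  induction n, h using Nat.le_induction with
  | base =>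
    rw [Finset.sum_congr rfl fun j hj => by rw [min_eq_left (Finset.mem_range.1 hj).le]]
    clear * -
    induction k with
    | zero => simp
    | succ a ih =>
      rw [Finset.sum_range_succ, mul_add, ih]
      push_cast
      ring
  | succ m hm ih =>
    rw [Finset.sum_range_succ, mul_add, ih, min_eq_right hm]
    push_cast
    ring

/-- A profile of minimal size among those of level `k + 1`. -/
lemma exists_minimal_profile (k n : ℕ) (h : k < n) :
    ∃ g, IsColumnProfile g ∧ blockCount g (g n) = k + 1 ∧
      2 * ∑ j ∈ Finset.range (n + 1), (g j : ℤ) = k * (2 * n - k - 1) + 2 * (k + 1) := by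
  refine ⟨fun j => if j < n then min j k else k + 1, ⟨fun a b hab => ?_, fun j => ?_⟩, ?_, ?_⟩
  · split_ifs <;> omega
  · split_ifs <;> omega
  · simp only [lt_irrefl, if_false]
    refine blockCount_eq_self _ fun j hj => ?_
    rw [if_pos (by omega)]
    omega
  · simp only [Finset.sum_range_succ, mul_add, lt_irrefl, if_false]
    rw [← two_mul_sum_min k n h.le,
      Finset.sum_congr rfl fun j hj => by rw [if_pos (Finset.mem_range.1 hj)]]
    push_cast
    ring

/-- A relation that is closed downwards on the left and upwards on the right comes from a
profile. -/
lemma exists_profile_of_rel (Q : ℕ → ℕ → Prop) (hlt : ∀ i j, Q i j → i < j)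
    (hl : ∀ i i' j, i' ≤ i → Q i j → Q i' j) (hr : ∀ i j j', j ≤ j' → Q i j → Q i j') :
    ∃ g, IsColumnProfile g ∧ ∀ i j, i < g j ↔ Q i j := by
  classical
  have hex : ∀ j, ∃ i, ¬ Q i j := fun j => ⟨j, fun h => lt_irrefl _ (hlt _ _ h)⟩
  have key : ∀ i j, i < Nat.find (hex j) ↔ Q i j := fun i j => by
    rw [Nat.lt_find_iff]
    exact ⟨fun h => not_not.1 (h i le_rfl), fun h m hm => not_not.2 (hl _ _ _ hm h)⟩
  refine ⟨fun j => Nat.find (hex j), ⟨fun a b hab => ?_, fun j => ?_⟩, key⟩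
  · refine le_of_forall_lt fun i hi => ?_
    exact (key i b).2 (hr _ _ _ hab ((key i a).1 hi))
  · refine le_of_forall_lt fun i hi => ?_
    exact hlt _ _ ((key i j).1 hi)

attribute [local instance 100] LieRing.ofAssociativeRing

/-- The standard Borel subalgebra of `sl(n+1, ℂ)`: the upper triangular traceless matrices. -/
def upperBorel (n : ℕ) : LieSubalgebra ℂ (SlC n) where
  carrier := {x | ∀ i j : Fin (n + 1), j < i → x.1 i j = 0}
  zero_mem' _ _ _ := rfl
  add_mem' {x y} hx hy i j h := by
    change x.1 i j + y.1 i j = 0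
    rw [hx i j h, hy i j h, add_zero]
  smul_mem' c x hx i j h := by
    change c * x.1 i j = 0
    rw [hx i j h, mul_zero]
  lie_mem' {x y} hx hy i j h := by
    have key : ∀ {x y : SlC n}, (∀ i j : Fin (n + 1), j < i → x.1 i j = 0) →
        (∀ i j : Fin (n + 1), j < i → y.1 i j = 0) → (x.1 * y.1) i j = 0 := by
      intro x y hx hy
      rw [Matrix.mul_apply]
      refine Finset.sum_eq_zero fun k _ => ?_
      rcases lt_or_ge k i with hk | hk
      · rw [hx i k hk, zero_mul]
      · rw [hy k j (h.trans_le hk), mul_zero]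
    rw [LieAlgebra.SpecialLinear.sl_bracket, Matrix.sub_apply, key hx hy, key hy hx, sub_zero]

namespace upperBorel

variable {n : ℕ}

lemma val_lie (x y : upperBorel n) : (⁅x, y⁆).1.1 = x.1.1 * y.1.1 - y.1.1 * x.1.1 :=
  LieAlgebra.SpecialLinear.sl_bracket _ _ _ _

/-- The matrix unit `E i j`, for `i < j`, as an element of the standard Borel subalgebra. -/
noncomputable def rootVector {i j : Fin (n + 1)} (h : i < j) : upperBorel n :=
  ⟨LieAlgebra.SpecialLinear.single i j h.ne 1, fun a b hab => by
    rw [LieAlgebra.SpecialLinear.val_single, Matrix.single_apply, if_neg]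
    rintro ⟨rfl, rfl⟩
    exact lt_asymm h hab⟩

lemma val_rootVector {i j : Fin (n + 1)} (h : i < j) :
    (rootVector h).1.1 = Matrix.single i j 1 :=
  LieAlgebra.SpecialLinear.val_single _ _ _ _

lemma lie_rootVector {a z j : Fin (n + 1)} (h₁ : a < z) (h₂ : z < j) :
    ⁅rootVector h₁, rootVector h₂⁆ = rootVector (h₁.trans h₂) := by
  apply Subtype.ext
  apply Subtype.ext
  rw [val_lie, val_rootVector, val_rootVector, val_rootVector, Matrix.single_mul_single_same,
    Matrix.single_mul_single_of_ne _ _ _ _ (h₁.trans h₂).ne', sub_zero, mul_one]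

/-- The projection of the matrix unit `E i i` to the traceless matrices. -/
noncomputable def coweight (i : Fin (n + 1)) : upperBorel n :=
  ⟨⟨Matrix.single i i 1 - ((n : ℂ) + 1)⁻¹ • 1, by
    have : (n : ℂ) + 1 ≠ 0 := by exact_mod_cast n.succ_ne_zero
    change Matrix.trace (Matrix.single i i 1 - ((n : ℂ) + 1)⁻¹ • (1 : Matrix _ _ ℂ)) = 0
    simp [Matrix.trace_sub, Matrix.trace_smul, this]⟩, fun a b hab => by
    have h1 : ¬ (i = a ∧ i = b) := by
      rintro ⟨rfl, rfl⟩
      exact lt_irrefl _ hab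
    simp [h1, hab.ne']⟩

lemma val_lie_coweight (i : Fin (n + 1)) (x : upperBorel n) (a b : Fin (n + 1)) :
    (⁅coweight i, x⁆).1.1 a b
      = ((if i = a then 1 else 0) - (if i = b then 1 else 0)) * x.1.1 a b := by
  rw [val_lie]
  have : (coweight i).1.1 = Matrix.single i i 1 - ((n : ℂ) + 1)⁻¹ • 1 := rfl
  rw [this, sub_mul, mul_sub, smul_one_mul, mul_smul_one, sub_sub_sub_cancel_right,
    Matrix.sub_apply, sub_mul]
  congr 1
  · by_cases h : i = a
    · subst h
      simp
    · simp [h, Matrix.single_mul_apply_of_ne _ _ _ _ _ (Ne.symm h)]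
  · by_cases h : i = b
    · subst h
      simp
    · simp [h, Matrix.mul_single_apply_of_ne _ _ _ _ _ (Ne.symm h)]

lemma lie_coweight_lie_coweight {i j : Fin (n + 1)} (h : i < j) (x : upperBorel n) :
    ⁅coweight i, ⁅coweight j, x⁆⁆ = (-x.1.1 i j) • rootVector h := by
  apply Subtype.ext
  apply Subtype.ext
  ext a b
  have e : ((-x.1.1 i j) • rootVector h).1.1 a b = -x.1.1 i j * (rootVector h).1.1 a b := rfl
  rw [e, val_lie_coweight, val_lie_coweight, val_rootVector, Matrix.single_apply]
  by_cases h1 : i = a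
  · by_cases h2 : j = b
    · subst h1 h2
      simp [h.ne, h.ne']
    · have h3 : j ≠ a := fun h' => h.ne (h1.trans h'.symm)
      simp [h1, h2, h3]
  · by_cases h2 : i = b
    · subst h2
      by_cases h3 : j = a
      · subst h3
        have := x.2 _ _ h
        simp [this, h1]
      · simp [h3, h1, h.ne']
    · simp [h1, h2]

lemma ad_apply_of_corner {x : SlC n} (hx : x ∈ upperBorel n) {i j : Fin (n + 1)} (y : SlC n)
    (hy : ∀ a b, i < a ∨ b < j → y.1 a b = 0) :
    (∀ a b, i < a ∨ b < j → (⁅x, y⁆).1 a b = 0) ∧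
      (⁅x, y⁆).1 i j = (x.1 i i - x.1 j j) * y.1 i j := by
  rw [LieAlgebra.SpecialLinear.sl_bracket]
  constructor
  · intro a b hab
    rw [Matrix.sub_apply, Matrix.mul_apply, Matrix.mul_apply, Finset.sum_eq_zero,
      Finset.sum_eq_zero, sub_zero]
    · intro k _
      rcases hab with h | h
      · rw [hy a k (Or.inl h), zero_mul]
      · rcases lt_or_ge b k with hk | hk
        · rw [hx k b hk, mul_zero]
        · rw [hy a k (Or.inr (hk.trans_lt h)), zero_mul]
    · intro k _
      rcases hab with h | h
      · rcases lt_or_ge k a with hk | hk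
        · rw [hx a k hk, zero_mul]
        · rw [hy k b (Or.inl (h.trans_le hk)), mul_zero]
      · rw [hy k b (Or.inr h), mul_zero]
  · rw [Matrix.sub_apply, Matrix.mul_apply, Matrix.mul_apply, Finset.sum_eq_single i,
      Finset.sum_eq_single j]
    · ring
    · intro k _ hk
      rcases lt_or_gt_of_ne hk with h | h
      · rw [hy i k (Or.inr h), zero_mul]
      · rw [hx k j h, mul_zero]
    · simp
    · intro k _ hk
      rcases lt_or_gt_of_ne hk with h | h
      · rw [hx i k h, zero_mul]
      · rw [hy k j (Or.inl h), mul_zero]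
    · simp

lemma diag_eq_zero_of_isNilpotent_ad {x : SlC n} (hx : x ∈ upperBorel n)
    (hnil : IsNilpotent (LieAlgebra.ad ℂ (SlC n) x)) (i : Fin (n + 1)) : x.1 i i = 0 := by
  obtain ⟨m, hm⟩ := hnil
  have hlt : ∀ i j : Fin (n + 1), i < j → x.1 i i = x.1 j j := by
    intro i j hij
    have key : ∀ m : ℕ, (∀ a b, i < a ∨ b < j →
        (((LieAlgebra.ad ℂ (SlC n) x) ^ m) (rootVector hij).1).1 a b = 0) ∧
        (((LieAlgebra.ad ℂ (SlC n) x) ^ m) (rootVector hij).1).1 i j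
          = (x.1 i i - x.1 j j) ^ m := by
      intro m
      induction m with
      | zero =>
        rw [pow_zero, Module.End.one_apply, val_rootVector]
        refine ⟨fun a b hab => ?_, by simp⟩
        rw [Matrix.single_apply, if_neg]
        rintro ⟨rfl, rfl⟩
        simp at hab
      | succ m ih =>
        rw [pow_succ', Module.End.mul_apply, LieAlgebra.ad_apply]
        obtain ⟨h1, h2⟩ := ad_apply_of_corner hx _ ih.1
        exact ⟨h1, by rw [h2, ih.2, pow_succ']⟩
    have := (key m).2
    rw [hm] at this
    have h0 : (x.1 i i - x.1 j j) ^ m = 0 := this.symm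
    exact sub_eq_zero.1 (eq_zero_of_pow_eq_zero h0)
  have heq : ∀ j, x.1 j j = x.1 i i := fun j => by
    rcases lt_trichotomy i j with h | h | h
    · exact (hlt i j h).symm
    · rw [h]
    · exact hlt j i h
  have htr : Matrix.trace x.1 = 0 := x.2
  rw [Matrix.trace, Finset.sum_congr rfl fun j _ => (Matrix.diag_apply _ j).trans (heq j)] at htr
  simp at htr
  rcases htr with h | h
  · exact absurd h (by exact_mod_cast n.succ_ne_zero)
  · exact h

end upperBorel

lemma IsColumnProfile.mul_apply_eq_zero {g : ℕ → ℕ} (hg : IsColumnProfile g) {n : ℕ}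
    {x y : Matrix (Fin (n + 1)) (Fin (n + 1)) ℂ} (hx : ∀ i j, j < i → x i j = 0)
    (hy : ∀ i j : Fin (n + 1), g j ≤ i → y i j = 0) (i j : Fin (n + 1)) (h : g j ≤ i) :
    (x * y) i j = 0 ∧ (y * x) i j = 0 := by
  rw [Matrix.mul_apply, Matrix.mul_apply]
  constructor
  · refine Finset.sum_eq_zero fun k _ => ?_
    rcases lt_or_ge k i with hk | hk
    · rw [hx i k hk, zero_mul]
    · rw [hy k j (h.trans hk), mul_zero]
  · refine Finset.sum_eq_zero fun k _ => ?_
    rcases lt_or_ge j k with hk | hk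
    · rw [hx k j hk, mul_zero]
    · rw [hy i k ((hg.mono hk).trans h), zero_mul]

/-- The ideal of the standard Borel subalgebra that consists of the matrices whose entries vanish
outside the pairs encoded by a column profile. -/
def IsColumnProfile.ideal {g : ℕ → ℕ} (hg : IsColumnProfile g) (n : ℕ) :
    LieIdeal ℂ (upperBorel n) where
  carrier := {x | ∀ i j : Fin (n + 1), g j ≤ i → x.1.1 i j = 0}
  zero_mem' _ _ _ := rfl
  add_mem' {x y} hx hy i j h := by
    change x.1.1 i j + y.1.1 i j = 0
    rw [hx i j h, hy i j h, add_zero]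
  smul_mem' c x hx i j h := by
    change c * x.1.1 i j = 0
    rw [hx i j h, mul_zero]
  lie_mem {x y} hy i j h := by
    obtain ⟨h1, h2⟩ := hg.mul_apply_eq_zero x.2 hy i j h
    rw [upperBorel.val_lie, Matrix.sub_apply, h1, h2, sub_zero]

namespace IsColumnProfile

variable {g : ℕ → ℕ} (hg : IsColumnProfile g) {n : ℕ}

lemma lt_of_ne_zero {x : upperBorel n} (hx : x ∈ hg.ideal n) {i j : Fin (n + 1)}
    (h : x.1.1 i j ≠ 0) : (i : ℕ) < g j :=
  not_le.1 fun h' => h (hx i j h')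

lemma rootVector_mem_ideal {i j : Fin (n + 1)} (h : i < j) (h' : (i : ℕ) < g j) :
    upperBorel.rootVector h ∈ hg.ideal n := by
  intro a b hab
  rw [upperBorel.val_rootVector, Matrix.single_apply, if_neg]
  rintro ⟨rfl, rfl⟩
  omega

lemma isAdNilpotentIdeal : IsAdNilpotentIdeal (hg.ideal n) := by
  intro x hx
  refine LieSubalgebra.isNilpotent_ad_of_isNilpotent_ad _
    (LieAlgebra.ad_nilpotent_of_nilpotent (R := ℂ) ⟨n + 1, ?_⟩)
  have key : ∀ m : ℕ, ∀ i j : Fin (n + 1), (j : ℕ) < i + m → (x.1.1 ^ m) i j = 0 := by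
    intro m
    induction m with
    | zero =>
      intro i j h
      rw [pow_zero, Matrix.one_apply_ne]
      rintro rfl
      omega
    | succ m ih =>
      intro i j h
      rw [pow_succ, Matrix.mul_apply]
      refine Finset.sum_eq_zero fun k _ => ?_
      rcases lt_or_ge (k : ℕ) (i + m) with hk | hk
      · rw [ih i k hk, zero_mul]
      · rw [hx k j (by have := hg.le j; omega), mul_zero]
  ext i j
  exact key _ _ _ (by have := j.2; omega)

lemma finrank_ideal : Module.finrank ℂ (hg.ideal n) = ∑ j ∈ Finset.range (n + 1), g j := by
  classical
  let S := {p : Fin (n + 1) × Fin (n + 1) // (p.1 : ℕ) < g p.2}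
  let f : hg.ideal n →ₗ[ℂ] (S → ℂ) :=
    { toFun := fun x p => x.1.1.1 p.1.1 p.1.2
      map_add' := fun _ _ => rfl
      map_smul' := fun _ _ => rfl }
  have hinj : Function.Injective f := by
    intro x y hxy
    apply Subtype.ext
    apply Subtype.ext
    apply Subtype.ext
    ext i j
    rcases lt_or_ge (i : ℕ) (g j) with h | h
    · exact congrFun hxy (⟨(i, j), h⟩ : S)
    · rw [x.2 i j h, y.2 i j h]
  have hsurj : Function.Surjective f := by
    intro v
    let M : Matrix (Fin (n + 1)) (Fin (n + 1)) ℂ :=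
      fun i j => if h : (i : ℕ) < g j then v ⟨(i, j), h⟩ else 0
    have hM : ∀ i j : Fin (n + 1), g j ≤ i → M i j = 0 := fun i j h => dif_neg (by omega)
    have htr : Matrix.trace M = 0 :=
      Finset.sum_eq_zero fun i _ => hM i i (hg.le i)
    refine ⟨⟨⟨⟨M, htr⟩, fun i j h => hM i j (by have := hg.le j; omega)⟩, hM⟩, ?_⟩
    ext p
    exact dif_pos p.2
  rw [(LinearEquiv.ofBijective f ⟨hinj, hsurj⟩).finrank_eq, Module.finrank_fintype_fun_eq_card,
    Fintype.card_subtype, Finset.card_filter, Fintype.sum_prod_type_right,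
    ← Fin.sum_univ_eq_sum_range]
  refine Finset.sum_congr rfl fun j _ => ?_
  dsimp only
  rw [← Finset.card_filter, Fin.card_filter_val_lt]
  have := hg.le j
  omega

lemma level_le_of_mem_lowerCentralSeries (m : ℕ) (x : hg.ideal n)
    (hx : x ∈ LieModule.lowerCentralSeries ℂ (hg.ideal n) (hg.ideal n) m) (i j : Fin (n + 1))
    (h : x.1.1.1 i j ≠ 0) : blockCount g (g i) + m + 1 ≤ blockCount g (g j) := by
  induction m generalizing x i j with
  | zero => exact hg.level_lt (hg.lt_of_ne_zero x.2 h)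
  | succ m ih =>
    rw [LieModule.lowerCentralSeries_succ, ← LieSubmodule.mem_toSubmodule,
      LieSubmodule.lieIdeal_oper_eq_linear_span'] at hx
    induction hx using Submodule.span_induction generalizing i j with
    | mem x hx =>
      obtain ⟨y, -, z, hz, rfl⟩ := hx
      have e : (⁅y, z⁆ : hg.ideal n).1.1.1 = y.1.1.1 * z.1.1.1 - z.1.1.1 * y.1.1.1 :=
        upperBorel.val_lie _ _
      rw [e, Matrix.sub_apply, Matrix.mul_apply, Matrix.mul_apply, ← Finset.sum_sub_distrib] at h
      obtain ⟨k, -, hk⟩ := Finset.exists_ne_zero_of_sum_ne_zero h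
      by_cases h1 : y.1.1.1 i k * z.1.1.1 k j = 0
      · rw [h1, zero_sub, neg_ne_zero] at hk
        have h2 := ih z hz i k (left_ne_zero_of_mul hk)
        have h3 := hg.level_lt (hg.lt_of_ne_zero y.2 (right_ne_zero_of_mul hk))
        omega
      · have h2 := ih z hz k j (right_ne_zero_of_mul h1)
        have h3 := hg.level_lt (hg.lt_of_ne_zero y.2 (left_ne_zero_of_mul h1))
        omega
    | zero => exact absurd rfl h
    | add x y _ _ hx hy =>
      by_cases h1 : x.1.1.1 i j = 0
      · refine hy i j fun h2 => h ?_
        change x.1.1.1 i j + y.1.1.1 i j = 0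
        rw [h1, h2, add_zero]
      · exact hx i j h1
    | smul c x _ hx =>
      refine hx i j fun h1 => h ?_
      change c * x.1.1.1 i j = 0
      rw [h1, mul_zero]

lemma exists_rootVector_mem_lowerCentralSeries (m : ℕ) (j : Fin (n + 1))
    (h : blockCount g (g j) = m + 1) :
    ∃ (a : Fin (n + 1)) (haj : a < j) (ha : upperBorel.rootVector haj ∈ hg.ideal n),
      (⟨_, ha⟩ : hg.ideal n) ∈ LieModule.lowerCentralSeries ℂ (hg.ideal n) (hg.ideal n) m := by
  have hpos : ∀ {j : Fin (n + 1)} {m : ℕ}, blockCount g (g j) = m + 1 → 0 < g j := by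
    intro j m h
    rcases Nat.eq_zero_or_pos (g j) with h0 | h0
    · rw [h0, blockCount_zero] at h
      omega
    · exact h0
  induction m generalizing j with
  | zero =>
    have h0 := hpos h
    have hj : (0 : Fin (n + 1)) < j := Fin.lt_def.2 (h0.trans_le (hg.le j))
    exact ⟨0, hj, hg.rootVector_mem_ideal hj h0, by simp⟩
  | succ m ih =>
    have h0 := hpos h
    have hle := hg.le j
    let z : Fin (n + 1) := ⟨g j - 1, by omega⟩
    have hz : z < j := Fin.lt_def.2 (by simp only [z]; omega)
    have hgz : g j = (z : ℕ) + 1 := by simp only [z]; omega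
    rw [hgz, hg.blockCount_succ] at h
    obtain ⟨a, haz, ha, hmem⟩ := ih z (by omega)
    have haj : (a : ℕ) < g j := by have := Fin.lt_def.1 haz; omega
    refine ⟨a, haz.trans hz, hg.rootVector_mem_ideal _ haj, ?_⟩
    rw [LieModule.lowerCentralSeries_succ]
    have := LieSubmodule.lie_mem_lie (LieSubmodule.mem_top
      (⟨_, hg.rootVector_mem_ideal hz (by omega)⟩ : hg.ideal n)) hmem
    rw [← neg_mem_iff]
    convert this using 1
    apply Subtype.ext
    change -upperBorel.rootVector (haz.trans hz) =
      ⁅upperBorel.rootVector hz, upperBorel.rootVector haz⁆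
    rw [← lie_skew, upperBorel.lie_rootVector]

lemma nilpotenceClass_ideal : nilpotenceClass (hg.ideal n) = blockCount g (g n) := by
  have hmax : ∀ j : Fin (n + 1), blockCount g (g j) ≤ blockCount g (g n) := fun j =>
    hg.blockCount_mono (hg.mono (by omega))
  have hbot : LieModule.lowerCentralSeries ℂ (hg.ideal n) (hg.ideal n)
      (blockCount g (g n)) = ⊥ := by
    rw [LieSubmodule.eq_bot_iff]
    intro x hx
    apply Subtype.ext
    apply Subtype.ext
    apply Subtype.ext
    ext i j
    by_contra h
    have h1 := hg.level_le_of_mem_lowerCentralSeries _ x hx i j h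
    have h2 := hmax j
    omega
  refine le_antisymm (Nat.sInf_le hbot) ?_
  refine le_csInf ⟨_, hbot⟩ fun m hm => ?_
  by_contra! hlt
  obtain ⟨c, hc⟩ : ∃ c, blockCount g (g n) = c + 1 := ⟨blockCount g (g n) - 1, by omega⟩
  obtain ⟨a, haj, ha, hmem⟩ :=
    hg.exists_rootVector_mem_lowerCentralSeries (n := n) c (Fin.last n) (by simpa using hc)
  have h0 := LieModule.antitone_lowerCentralSeries ℂ (hg.ideal n) (hg.ideal n)
    (show m ≤ c by omega) hmem
  rw [Set.mem_ofPred_eq] at hm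
  rw [hm, LieSubmodule.mem_bot] at h0
  have h1 : (upperBorel.rootVector haj).1.1 a (Fin.last n) = 0 := by
    have h2 : upperBorel.rootVector haj = 0 := congrArg Subtype.val h0
    rw [h2]
    rfl
  rw [upperBorel.val_rootVector] at h1
  simp at h1

end IsColumnProfile

/-- Every ad-nilpotent ideal of the standard Borel subalgebra comes from a column profile. -/
lemma IsAdNilpotentIdeal.exists_profile {n : ℕ} {I : LieIdeal ℂ (upperBorel n)}
    (hI : IsAdNilpotentIdeal I) : ∃ (g : ℕ → ℕ) (hg : IsColumnProfile g), I = hg.ideal n := by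
  have hdiag : ∀ x ∈ I, ∀ i, x.1.1 i i = 0 := fun x hx i =>
    upperBorel.diag_eq_zero_of_isNilpotent_ad x.2 (hI x hx) i
  have hroot : ∀ x ∈ I, ∀ (i j : Fin (n + 1)) (h : i < j), x.1.1 i j ≠ 0 →
      upperBorel.rootVector h ∈ I := by
    intro x hx i j h hne
    have h1 : ⁅upperBorel.coweight i, ⁅upperBorel.coweight j, x⁆⁆ ∈ I :=
      I.lie_mem (I.lie_mem hx)
    rw [upperBorel.lie_coweight_lie_coweight h] at h1
    exact (I.toSubmodule.smul_mem_iff (neg_ne_zero.2 hne)).1 h1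
  let Q : ℕ → ℕ → Prop := fun i j => i < j ∧ ∀ (a b : Fin (n + 1)) (h : a < b),
    (a : ℕ) = i → (b : ℕ) = j → upperBorel.rootVector h ∈ I
  obtain ⟨g, hg, hgQ⟩ := exists_profile_of_rel Q (fun i j h => h.1)
    (by
      rintro i i' j hi ⟨hij, h⟩
      refine ⟨by omega, ?_⟩
      rintro a b hab rfl rfl
      rcases hi.eq_or_lt with rfl | hlt
      · exact h a b hab rfl rfl
      · have hz : (⟨i, hij.trans b.2⟩ : Fin (n + 1)) < b := hij
        rw [← upperBorel.lie_rootVector (z := ⟨i, hij.trans b.2⟩) hlt hz]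
        exact I.lie_mem (h _ b hz rfl rfl))
    (by
      rintro i j j' hj ⟨hij, h⟩
      refine ⟨by omega, ?_⟩
      rintro a b hab rfl rfl
      rcases hj.eq_or_lt with rfl | hlt
      · exact h a b hab rfl rfl
      · have hz : a < (⟨j, hlt.trans b.2⟩ : Fin (n + 1)) := hij
        rw [← upperBorel.lie_rootVector (z := ⟨j, hlt.trans b.2⟩) hz hlt, ← lie_skew]
        exact neg_mem (I.lie_mem (h a _ hz rfl rfl)))
  have hQ : ∀ (i j : Fin (n + 1)) (h : i < j),
      (i : ℕ) < g j ↔ upperBorel.rootVector h ∈ I := by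
    intro i j h
    rw [hgQ]
    refine ⟨fun h' => h'.2 i j h rfl rfl, fun h' => ⟨h, fun a b hab ha hb => ?_⟩⟩
    obtain rfl := Fin.ext ha
    obtain rfl := Fin.ext hb
    exact h'
  refine ⟨g, hg, LieSubmodule.ext _ _ fun x => ⟨fun hx i j hij => ?_, fun hx => ?_⟩⟩
  · by_contra hne
    rcases lt_trichotomy i j with h | h | h
    · exact absurd ((hQ i j h).2 (hroot x hx i j h hne)) (by omega)
    · subst h
      exact hne (hdiag x hx i)
    · exact hne (x.2 i j h)
  · have hsum : x = ∑ i, ∑ j, if h : i < j then x.1.1 i j • upperBorel.rootVector h else 0 := by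
      apply Subtype.ext
      apply Subtype.ext
      ext a b
      let entry : upperBorel n →ₗ[ℂ] ℂ :=
        { toFun := fun y => y.1.1 a b
          map_add' := fun _ _ => rfl
          map_smul' := fun _ _ => rfl }
      have he : ∀ i j, entry (if h : i < j then x.1.1 i j • upperBorel.rootVector h else 0)
          = if i = a ∧ j = b then x.1.1 a b else 0 := by
        intro i j
        split_ifs with h h' h'
        · obtain ⟨rfl, rfl⟩ := h'
          rw [map_smul]
          change x.1.1 i j * (upperBorel.rootVector h).1.1 i j = _
          simp [upperBorel.val_rootVector]
        · rw [map_smul]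
          change x.1.1 i j * (upperBorel.rootVector h).1.1 a b = _
          rw [upperBorel.val_rootVector, Matrix.single_apply, if_neg h', mul_zero]
        · obtain ⟨rfl, rfl⟩ := h'
          rw [map_zero, hx i j ((hg.le j).trans (not_lt.1 h))]
        · rw [map_zero]
      change entry x = entry _
      simp only [map_sum, he]
      change x.1.1 a b = _
      simp [ite_and]
    rw [hsum]
    refine sum_mem fun i _ => sum_mem fun j _ => ?_
    split_ifs with h
    · by_cases h0 : x.1.1 i j = 0
      · rw [h0, zero_smul]
        exact zero_mem _
      · exact I.toSubmodule.smul_mem _ ((hQ i j h).1 (hg.lt_of_ne_zero hx h0))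
    · exact zero_mem _

/-- **Lie's theorem** in matrix form: a finite-dimensional module over a solvable Lie algebra has a
basis with respect to which the Lie algebra acts by lower triangular matrices. -/
lemma LieModule.exists_triangular_basis {L : Type*} [LieRing L] [LieAlgebra ℂ L]
    [LieAlgebra.IsSolvable L] (d : ℕ) (V : Type*) [AddCommGroup V] [Module ℂ V] [LieRingModule L V]
    [LieModule ℂ L V] [Module.Finite ℂ V] (hd : Module.finrank ℂ V = d) :
    ∃ b : Module.Basis (Fin d) ℂ V, ∀ (x : L) (i j : Fin d), i < j → b.repr ⁅x, b j⁆ i = 0 := by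
  induction d generalizing V with
  | zero => exact ⟨Module.finBasisOfFinrankEq ℂ V hd, fun _ i => i.elim0⟩
  | succ d ih =>
    have : Nontrivial V := Module.nontrivial_of_finrank_pos (R := ℂ) (by omega)
    have : Nontrivial (V →ₗ[ℂ] ℂ) := inferInstanceAs (Nontrivial (Module.Dual ℂ V))
    obtain ⟨χ, hχ⟩ := LieModule.exists_nontrivial_weightSpace_of_isSolvable ℂ L (V →ₗ[ℂ] ℂ)
    obtain ⟨⟨f, hf⟩, hf0⟩ := exists_ne (0 : LieModule.weightSpace (V →ₗ[ℂ] ℂ) χ)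
    rw [LieModule.mem_weightSpace] at hf
    have hf0' : f ≠ 0 := fun h => hf0 (Subtype.ext h)
    have hfx : ∀ (x : L) (v : V), f ⁅x, v⁆ = - (χ x * f v) := by
      intro x v
      have := congrArg (fun φ : V →ₗ[ℂ] ℂ => φ v) (hf x)
      simp only [Module.Dual.lie_apply, LinearMap.smul_apply, smul_eq_mul] at this
      rw [← this, neg_neg]
    let W : LieSubmodule ℂ L V :=
      { LinearMap.ker f with
        lie_mem := by
          intro x v hv
          change f ⁅x, v⁆ = 0
          have hv' : f v = 0 := hv
          rw [hfx, hv', mul_zero, neg_zero] }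
    have hW : Module.finrank ℂ W = d := by
      have h1 := Module.Dual.finrank_ker_add_one_of_ne_zero (f := f) hf0'
      have h2 : Module.finrank ℂ W = Module.finrank ℂ (LinearMap.ker f) := rfl
      omega
    obtain ⟨b, hb⟩ := ih W hW
    obtain ⟨y, hy⟩ : ∃ y, f y ≠ 0 := by
      by_contra! h
      exact hf0' (LinearMap.ext h)
    let c : Module.Basis (Fin (d + 1)) ℂ V := Module.Basis.mkFinCons (N := W.toSubmodule) y b
      (by
        intro a w hw h
        have hw' : f w = 0 := hw
        have := congrArg f h
        rw [map_add, map_smul, hw', map_zero, add_zero, smul_eq_mul] at this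
        exact (mul_eq_zero.1 this).resolve_right hy)
      (by
        intro z
        refine ⟨-(f z / f y), ?_⟩
        change f (z + -(f z / f y) • y) = 0
        rw [map_add, map_smul, smul_eq_mul]
        field_simp
        ring)
    have hc0 : c 0 = y := by simp [c]
    have hcs : ∀ i : Fin d, c i.succ = b i := fun i => by simp [c]
    have hrepr : ∀ w : W, ∀ i : Fin d, c.repr w i.succ = b.repr w i ∧ c.repr w 0 = 0 := by
      intro w i
      have : (w : V) = ∑ k, b.repr w k • c k.succ := by
        have h := congrArg W.toSubmodule.subtype (b.sum_repr w)
        rw [map_sum] at h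
        refine h.symm.trans (Finset.sum_congr rfl fun k _ => ?_)
        rw [hcs, map_smul]
        rfl
      rw [this]
      simp [Finsupp.single_apply]
    refine ⟨c, fun x i j hij => ?_⟩
    obtain ⟨j, rfl⟩ : ∃ k : Fin d, j = k.succ :=
      ⟨j.pred (Fin.ne_zero_of_lt hij), (Fin.succ_pred _ _).symm⟩
    rw [hcs]
    have hlie : ⁅x, (b j : V)⁆ = ((⁅x, b j⁆ : W) : V) := rfl
    rw [hlie]
    cases i using Fin.cases with
    | zero => exact (hrepr _ j).2
    | succ i =>
      rw [(hrepr _ i).1]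
      exact hb x i j (Fin.succ_lt_succ_iff.1 hij)

namespace upperBorel

lemma derivedSeries_le (n m : ℕ) (x : upperBorel n)
    (hx : x ∈ LieAlgebra.derivedSeries ℂ (upperBorel n) m) (i j : Fin (n + 1))
    (h : (j : ℕ) < i + m) : x.1.1 i j = 0 := by
  induction m generalizing x i j with
  | zero => exact x.2 i j h
  | succ m ih =>
    rw [LieAlgebra.derivedSeries_def, LieAlgebra.derivedSeriesOfIdeal_succ,
      ← LieAlgebra.derivedSeries_def, ← LieSubmodule.mem_toSubmodule,
      LieSubmodule.lieIdeal_oper_eq_linear_span'] at hx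
    induction hx using Submodule.span_induction generalizing i j with
    | mem x hx =>
      obtain ⟨y, hy, z, hz, rfl⟩ := hx
      rw [val_lie, Matrix.sub_apply, Matrix.mul_apply, Matrix.mul_apply,
        ← Finset.sum_sub_distrib]
      refine Finset.sum_eq_zero fun k _ => ?_
      have key : ∀ {y z : upperBorel n}, y ∈ LieAlgebra.derivedSeries ℂ (upperBorel n) m →
          z ∈ LieAlgebra.derivedSeries ℂ (upperBorel n) m →
          ((k : ℕ) < i + m ∨ (j : ℕ) < k + m) → y.1.1 i k * z.1.1 k j = 0 := by
        rintro y z hy hz (h | h)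
        · rw [ih y hy i k h, zero_mul]
        · rw [ih z hz k j h, mul_zero]
      by_cases hk : (k : ℕ) < i + m ∨ (j : ℕ) < k + m
      · rw [key hy hz hk, key hz hy hk, sub_zero]
      · obtain ⟨rfl, rfl⟩ : i = k ∧ j = k := by
          constructor <;> apply Fin.ext <;> omega
        ring
    | zero => rfl
    | add x y _ _ hx hy =>
      change x.1.1 i j + y.1.1 i j = 0
      rw [hx i j h, hy i j h, add_zero]
    | smul c x _ hx =>
      change c * x.1.1 i j = 0
      rw [hx i j h, mul_zero]

instance isSolvable (n : ℕ) : LieAlgebra.IsSolvable (upperBorel n) := by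
  refine LieAlgebra.IsSolvable.mk (R := ℂ) (k := n + 1) ?_
  rw [LieSubmodule.eq_bot_iff]
  intro x hx
  apply Subtype.ext
  apply Subtype.ext
  ext i j
  exact derivedSeries_le n _ x hx i j (by have := j.2; omega)

end upperBorel

/-- A solvable subalgebra of `sl(n+1, ℂ)` is conjugate to a subalgebra of the standard Borel
subalgebra. -/
lemma exists_lieEquiv_mem_upperBorel (n : ℕ) (s : LieSubalgebra ℂ (SlC n))
    [LieAlgebra.IsSolvable s] :
    ∃ e : SlC n ≃ₗ⁅ℂ⁆ SlC n, ∀ x ∈ s, e x ∈ upperBorel n := by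
  let φ : s →ₗ⁅ℂ⁆ Module.End ℂ (Fin (n + 1) → ℂ) :=
    (lieEquivMatrix'.symm.toLieHom.comp
      (LieAlgebra.SpecialLinear.sl (Fin (n + 1)) ℂ).incl).comp s.incl
  have hφ : ∀ x, φ x = Matrix.toLin' x.1.1 := fun x => rfl
  let _ : LieRingModule s (Fin (n + 1) → ℂ) := LieRingModule.compLieHom _ φ
  have _ : LieModule ℂ s (Fin (n + 1) → ℂ) := LieModule.compLieHom _ φ
  obtain ⟨b₀, hb₀⟩ := LieModule.exists_triangular_basis (L := s) (n + 1) (Fin (n + 1) → ℂ) (by simp)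
  have hb₁ : ∀ (x : s) (i j : Fin (n + 1)), i < j →
      b₀.repr (Matrix.toLin' x.1.1 (b₀ j)) i = 0 := hb₀
  let b := b₀.reindex Fin.revPerm
  let e₀ : Matrix (Fin (n + 1)) (Fin (n + 1)) ℂ ≃ₗ⁅ℂ⁆ Matrix (Fin (n + 1)) (Fin (n + 1)) ℂ :=
    { (Matrix.toLinAlgEquiv'.trans (LinearMap.toMatrixAlgEquiv b)).toLinearEquiv with
      map_lie' := by
        intro x y
        change (Matrix.toLinAlgEquiv'.trans (LinearMap.toMatrixAlgEquiv b)) ⁅x, y⁆ = _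
        rw [LieRing.of_associative_ring_bracket, map_sub, map_mul, map_mul]
        rfl }
  have he₀ : ∀ x, e₀ x = LinearMap.toMatrix b b (Matrix.toLin' x) := fun x => rfl
  have htr : ∀ x, Matrix.trace (e₀ x) = Matrix.trace x := by
    intro x
    rw [he₀, ← LinearMap.trace_eq_matrix_trace, Matrix.trace_toLin'_eq]
  have hmap : (LieAlgebra.SpecialLinear.sl (Fin (n + 1)) ℂ).map e₀.toLieHom
      = LieAlgebra.SpecialLinear.sl (Fin (n + 1)) ℂ := by
    ext y
    rw [LieSubalgebra.mem_map]
    constructor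
    · rintro ⟨x, hx, rfl⟩
      exact (htr x).trans hx
    · intro hy
      refine ⟨e₀.symm y, ?_, e₀.apply_symm_apply y⟩
      have := htr (e₀.symm y)
      rw [e₀.apply_symm_apply] at this
      exact this.symm.trans hy
  refine ⟨LieEquiv.ofSubalgebras _ _ e₀ hmap, fun x hx i j hij => ?_⟩
  change e₀ x.1 i j = 0
  rw [he₀, LinearMap.toMatrix_apply]
  simp only [b, Module.Basis.reindex_apply, Module.Basis.repr_reindex_apply, Fin.revPerm_symm,
    Fin.revPerm_apply]
  exact hb₁ ⟨x, hx⟩ _ _ (Fin.rev_lt_rev.2 hij)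

/-- Borel subalgebras of `sl(n+1, ℂ)` are conjugate to the standard one. -/
lemma IsBorelSubalgebra.exists_lieEquiv {n : ℕ} {b : LieSubalgebra ℂ (SlC n)}
    (hb : IsBorelSubalgebra b) :
    ∃ e : SlC n ≃ₗ⁅ℂ⁆ SlC n, ∀ x, x ∈ b ↔ e x ∈ upperBorel n := by
  have := hb.prop
  obtain ⟨e, he⟩ := exists_lieEquiv_mem_upperBorel n b
  refine ⟨e, fun x => ⟨he x, fun hx => ?_⟩⟩
  let t : LieSubalgebra ℂ (SlC n) := (upperBorel n).comap e.toLieHom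
  have ht : LieAlgebra.IsSolvable t := by
    let f : t →ₗ⁅ℂ⁆ upperBorel n :=
      { toFun := fun x => ⟨e x.1, x.2⟩
        map_add' := fun x y => Subtype.ext (map_add e x.1 y.1)
        map_smul' := fun c x => Subtype.ext (map_smul e c x.1)
        map_lie' := fun {x y} => Subtype.ext (LieEquiv.map_lie e x.1 y.1) }
    have hf : Function.Injective f := fun x y h =>
      Subtype.ext (e.injective (congrArg Subtype.val h))
    exact hf.lieAlgebra_isSolvable
  exact hb.le_of_ge ht (fun y hy => he y hy) hx

lemma lowerCentralSeries_eq_bot_of_lieEquiv {N N' : Type*} [LieRing N] [LieAlgebra ℂ N]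
    [LieRing N'] [LieAlgebra ℂ N'] (e : N ≃ₗ⁅ℂ⁆ N') (m : ℕ)
    (h : LieModule.lowerCentralSeries ℂ N N m = ⊥) :
    LieModule.lowerCentralSeries ℂ N' N' m = ⊥ := by
  rw [← LieIdeal.lowerCentralSeries_map_eq m (f := e.toLieHom) e.surjective, h,
    LieIdeal.map_eq_bot_iff]
  exact bot_le

lemma nilpotenceClass_eq_of_lieEquiv {N N' : Type*} [LieRing N] [LieAlgebra ℂ N]
    [LieRing N'] [LieAlgebra ℂ N'] (e : N ≃ₗ⁅ℂ⁆ N') : nilpotenceClass N = nilpotenceClass N' := by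
  rw [nilpotenceClass, nilpotenceClass]
  congr 1
  ext m
  exact ⟨lowerCentralSeries_eq_bot_of_lieEquiv e m, lowerCentralSeries_eq_bot_of_lieEquiv e.symm m⟩

lemma nilpotenceClasses_subset {L L' : Type*} [LieRing L] [LieAlgebra ℂ L] [LieRing L']
    [LieAlgebra ℂ L'] (e : L ≃ₗ⁅ℂ⁆ L') (b : LieSubalgebra ℂ L) (b' : LieSubalgebra ℂ L')
    (h : ∀ x, x ∈ b ↔ e x ∈ b') (A : ℕ) : nilpotenceClasses b' A ⊆ nilpotenceClasses b A := by
  rintro k ⟨I, hI, rfl, rfl⟩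
  let f : b →ₗ⁅ℂ⁆ b' :=
    { toFun := fun x => ⟨e x.1, (h _).1 x.2⟩
      map_add' := fun x y => Subtype.ext (map_add e x.1 y.1)
      map_smul' := fun c x => Subtype.ext (map_smul e c x.1)
      map_lie' := fun {x y} => Subtype.ext (LieEquiv.map_lie e x.1 y.1) }
  let F : I.comap f →ₗ⁅ℂ⁆ I :=
    { toFun := fun x => ⟨f x.1, LieIdeal.mem_comap.1 x.2⟩
      map_add' := fun x y => Subtype.ext (map_add f x.1 y.1)
      map_smul' := fun c x => Subtype.ext (map_smul f c x.1)
      map_lie' := fun {x y} => Subtype.ext (LieHom.map_lie f x.1 y.1) }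
  have hF : Function.Bijective F := by
    constructor
    · intro x y hxy
      have : e x.1.1 = e y.1.1 := congrArg (fun z : I => z.1.1) hxy
      exact Subtype.ext (Subtype.ext (e.injective this))
    · intro y
      have hy : e.symm y.1.1 ∈ b := by
        rw [h, e.apply_symm_apply]
        exact y.1.2
      have hfy : f ⟨_, hy⟩ = y.1 := Subtype.ext (e.apply_symm_apply _)
      exact ⟨⟨⟨_, hy⟩, LieIdeal.mem_comap.2 (by rw [hfy]; exact y.2)⟩, Subtype.ext hfy⟩
  let E := LieEquiv.ofBijective F hF
  refine ⟨I.comap f, fun x hx => ?_, E.toLinearEquiv.finrank_eq, nilpotenceClass_eq_of_lieEquiv E⟩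
  obtain ⟨m, hm⟩ := hI _ (LieIdeal.mem_comap.1 hx)
  refine ⟨m, LinearMap.ext fun y => e.injective ?_⟩
  have key : ∀ m : ℕ, e (((LieAlgebra.ad ℂ L x.1) ^ m) y)
      = ((LieAlgebra.ad ℂ L' (e x.1)) ^ m) (e y) := by
    intro m
    induction m with
    | zero => rfl
    | succ m ih =>
      rw [pow_succ', pow_succ', Module.End.mul_apply, Module.End.mul_apply, ← ih,
        LieAlgebra.ad_apply, LieAlgebra.ad_apply, LieEquiv.map_lie]
  change e (((LieAlgebra.ad ℂ L x.1) ^ m) y) = e 0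
  rw [key]
  have hm' : (LieAlgebra.ad ℂ L' (e x.1)) ^ m = 0 := hm
  rw [hm', LinearMap.zero_apply, map_zero]

lemma IsBorelSubalgebra.nilpotenceClasses_eq {n : ℕ} {b : LieSubalgebra ℂ (SlC n)}
    (hb : IsBorelSubalgebra b) (A : ℕ) :
    nilpotenceClasses b A = nilpotenceClasses (upperBorel n) A := by
  obtain ⟨e, he⟩ := hb.exists_lieEquiv
  refine (nilpotenceClasses_subset e.symm _ _ (fun x => ?_) A).antisymm
    (nilpotenceClasses_subset e _ _ he A)
  rw [he, e.apply_symm_apply]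

lemma mem_nilpotenceClasses_upperBorel {n A k : ℕ} :
    k ∈ nilpotenceClasses (upperBorel n) A ↔ ∃ g, IsColumnProfile g ∧
      ∑ j ∈ Finset.range (n + 1), g j = A ∧ blockCount g (g n) = k := by
  constructor
  · rintro ⟨I, hI, hA, hk⟩
    obtain ⟨g, hg, rfl⟩ := hI.exists_profile
    exact ⟨g, hg, hg.finrank_ideal.symm.trans hA, hg.nilpotenceClass_ideal.symm.trans hk⟩
  · rintro ⟨g, hg, hA, hk⟩
    exact ⟨hg.ideal n, hg.isAdNilpotentIdeal, hg.finrank_ideal.trans hA,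
      hg.nilpotenceClass_ideal.trans hk⟩

lemma two_mul_maxDimFormula (n k : ℕ) :
    2 * maxDimFormula n k = ((n + 1 : ℕ) : ℤ) ^ 2
      - (2 * ((n + 1) / (k + 1) : ℕ) + 1) * ((n + 1 : ℕ) : ℤ)
      + ((k + 1 : ℕ) : ℤ) * (((n + 1) / (k + 1) : ℕ) * (((n + 1) / (k + 1) : ℕ) + 1)) := by
  have h : ∀ m : ℕ, 2 * (((m + 1).choose 2 : ℕ) : ℤ) = (m + 1) * m := by
    intro m
    rw [Nat.choose_two_right, Nat.add_sub_cancel]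
    exact_mod_cast Nat.mul_div_cancel' (Nat.even_mul_pred_self (m + 1)).two_dvd
  rw [maxDimFormula, mul_add, mul_sub, h n, mul_left_comm 2, mul_left_comm 2, h]
  push_cast
  ring

lemma sum_range_id_eq_choose (n : ℕ) : ∑ j ∈ Finset.range (n + 1), j = (n + 1).choose 2 := by
  rw [Finset.sum_range_id, Nat.choose_two_right]

lemma IsColumnProfile.sum_le_maxDimFormula {g : ℕ → ℕ} (hg : IsColumnProfile g) (n : ℕ) :
    ((∑ j ∈ Finset.range (n + 1), g j : ℕ) : ℤ) ≤ maxDimFormula n (blockCount g (g n)) := by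
  have h1 := two_mul_maxDimFormula n (blockCount g (g n))
  have h2 := hg.two_mul_sum_le (((n + 1) / (blockCount g (g n) + 1) : ℕ) : ℤ) (n + 1)
  rw [hg.blockCount_succ] at h2
  rw [Nat.cast_sum]
  linarith

lemma exists_profile_sum_eq_maxDimFormula (n k : ℕ) :
    ∃ g, IsColumnProfile g ∧ blockCount g (g n) ≤ k ∧
      ((∑ j ∈ Finset.range (n + 1), g j : ℕ) : ℤ) = maxDimFormula n k := by
  obtain ⟨g, hg, hc, hs⟩ := exists_balanced_profile ((n + 1) / (k + 1)) (k + 1) (n + 1)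
    (Nat.mul_div_le _ _) (Nat.lt_mul_div_succ _ k.succ_pos).le
  rw [hg.blockCount_succ] at hc
  have h1 := two_mul_maxDimFormula n k
  refine ⟨g, hg, by omega, ?_⟩
  rw [Nat.cast_sum]
  linarith

lemma choose_two_le_maxDimFormula (n : ℕ) : (((n + 1).choose 2 : ℕ) : ℤ) ≤ maxDimFormula n n := by
  simp [maxDimFormula, Nat.div_self]

lemma exists_isLeast_nilpotenceClasses (n A : ℕ) (hA : A ≤ (n + 1).choose 2) :
    ∃ kmin : ℕ, IsLeast (nilpotenceClasses (upperBorel n) A) kmin ∧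
      IsLeast {k : ℕ | (A : ℤ) ≤ maxDimFormula n k} kmin := by
  have hne : ∃ k, (A : ℤ) ≤ maxDimFormula n k :=
    ⟨n, le_trans (by exact_mod_cast hA) (choose_two_le_maxDimFormula n)⟩
  classical
  have hleast : IsLeast {k : ℕ | (A : ℤ) ≤ maxDimFormula n k} (Nat.find hne) :=
    ⟨Nat.find_spec hne, fun m hm => Nat.find_min' hne hm⟩
  have hlb : ∀ k ∈ nilpotenceClasses (upperBorel n) A, Nat.find hne ≤ k := by
    intro k hk
    obtain ⟨g, hg, rfl, rfl⟩ := mem_nilpotenceClasses_upperBorel.1 hk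
    exact hleast.2 (hg.sum_le_maxDimFormula n)
  obtain ⟨g, hg, hc, hs⟩ := exists_profile_sum_eq_maxDimFormula n (Nat.find hne)
  have hA' : A ≤ ∑ j ∈ Finset.range (n + 1), g j := by
    have := hleast.1
    rw [Set.mem_ofPred_eq, ← hs] at this
    exact_mod_cast this
  obtain ⟨g', hg', hle, hs'⟩ := hg.exists_le_of_le_sum (n + 1) A hA'
  have hmem : blockCount g' (g' n) ∈ nilpotenceClasses (upperBorel n) A :=
    mem_nilpotenceClasses_upperBorel.2 ⟨g', hg', hs', rfl⟩
  have h1 := (hg'.blockCount_mono (hle n)).trans ((hg'.blockCount_le_of_le hg hle _).trans hc)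
  rw [h1.antisymm (hlb _ hmem)] at hmem
  exact ⟨_, ⟨hmem, hlb⟩, hleast⟩

lemma natCast_le_floor_iff {n k A : ℕ} (hk : k ≤ n) :
    (k : ℤ) ≤ ⌊(n : ℝ) + 3 / 2
        - 1 / 2 * Real.sqrt (4 * (n : ℝ) ^ 2 + 4 * (n : ℝ) + 9 - 8 * (A : ℝ))⌋ ↔
      2 * ((n : ℤ) + 1) * k - 2 * n - k * (k - 1) ≤ 2 * A := by
  have hk' : (k : ℝ) ≤ n := by exact_mod_cast hk
  rw [Int.le_floor, ← @Int.cast_le ℝ]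
  push_cast
  have h1 : (k : ℝ) ≤ (n : ℝ) + 3 / 2
      - 1 / 2 * Real.sqrt (4 * (n : ℝ) ^ 2 + 4 * (n : ℝ) + 9 - 8 * (A : ℝ)) ↔
      Real.sqrt (4 * (n : ℝ) ^ 2 + 4 * (n : ℝ) + 9 - 8 * (A : ℝ)) ≤ 2 * n + 3 - 2 * k := by
    constructor <;> intro h <;> linarith
  rw [h1, Real.sqrt_le_left (by linarith)]
  constructor <;> intro h <;> nlinarith

lemma floor_le_of_le_choose {n A : ℕ} (hA : A ≤ (n + 1).choose 2) :
    ⌊(n : ℝ) + 3 / 2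
      - 1 / 2 * Real.sqrt (4 * (n : ℝ) ^ 2 + 4 * (n : ℝ) + 9 - 8 * (A : ℝ))⌋ ≤ n := by
  have hA' : 2 * (A : ℝ) ≤ n * (n + 1) := by
    rw [← sum_range_id_eq_choose] at hA
    have := Finset.sum_range_id_mul_two (n + 1)
    rw [Nat.add_sub_cancel] at this
    have h : 2 * A ≤ n * (n + 1) := by nlinarith
    exact_mod_cast h
  have h3 : (3 : ℝ) ≤ Real.sqrt (4 * (n : ℝ) ^ 2 + 4 * (n : ℝ) + 9 - 8 * (A : ℝ)) :=
    Real.le_sqrt_of_sq_le (by nlinarith)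
  rw [← Int.cast_natCast (R := ℤ), Int.cast_id, ← Int.lt_add_one_iff, Int.floor_lt]
  push_cast
  linarith

lemma exists_isGreatest_nilpotenceClasses (n A : ℕ) (hA : A ≤ (n + 1).choose 2) :
    ∃ kmax : ℕ, IsGreatest (nilpotenceClasses (upperBorel n) A) kmax ∧
      (kmax : ℤ) = ⌊(n : ℝ) + 3 / 2
        - 1 / 2 * Real.sqrt (4 * (n : ℝ) ^ 2 + 4 * (n : ℝ) + 9 - 8 * (A : ℝ))⌋ := by
  have hfloor := floor_le_of_le_choose hA
  have hiff := fun k (hk : k ≤ n) => natCast_le_floor_iff (A := A) hk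
  set F := ⌊(n : ℝ) + 3 / 2
        - 1 / 2 * Real.sqrt (4 * (n : ℝ) ^ 2 + 4 * (n : ℝ) + 9 - 8 * (A : ℝ))⌋
  have hF0 : 0 ≤ F := by
    have := (hiff 0 (Nat.zero_le n)).2 (by push_cast; linarith)
    exact_mod_cast this
  obtain ⟨K, hK⟩ := Int.eq_ofNat_of_zero_le hF0
  rw [hK] at hfloor hiff
  have hKn : K ≤ n := by exact_mod_cast hfloor
  have hub : ∀ k ∈ nilpotenceClasses (upperBorel n) A, k ≤ K := by
    intro k hk
    obtain ⟨g, hg, rfl, rfl⟩ := mem_nilpotenceClasses_upperBorel.1 hk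
    have h1 := hg.le_two_mul_sum n
    have h2 := (hiff _ ((blockCount_le g (g n)).trans (hg.le n))).2 (by
      rw [Nat.cast_sum]
      exact h1)
    exact_mod_cast h2
  obtain ⟨g, hg, hc, hs⟩ : ∃ g, IsColumnProfile g ∧ K ≤ blockCount g (g n) ∧
      ∑ j ∈ Finset.range (n + 1), g j ≤ A := by
    cases K with
    | zero => exact ⟨_, isColumnProfile_zero, by simp, by simp⟩
    | succ k =>
      obtain ⟨g, hg, hc, hs⟩ := exists_minimal_profile k n hKn
      refine ⟨g, hg, hc.ge, ?_⟩
      have h1 := (hiff (k + 1) hKn).1 le_rfl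
      have h2 : 2 * ((∑ j ∈ Finset.range (n + 1), g j : ℕ) : ℤ) ≤ 2 * A := by
        rw [Nat.cast_sum, hs]
        push_cast at h1
        linarith
      omega
  obtain ⟨g', hg', hle, hs'⟩ := hg.exists_le_of_sum_le (n + 1) A hs
    (by rwa [sum_range_id_eq_choose])
  have hmem : blockCount g' (g' n) ∈ nilpotenceClasses (upperBorel n) A :=
    mem_nilpotenceClasses_upperBorel.2 ⟨g', hg', hs', rfl⟩
  have h1 := hc.trans ((hg.blockCount_mono (hle n)).trans (hg.blockCount_le_of_le hg' hle _))
  rw [← h1.antisymm (hub _ hmem)] at hmem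
  exact ⟨K, ⟨hmem, hub⟩, hK.symm⟩

theorem theorem6p3 (n : ℕ) (hn : 1 ≤ n)
    (b : LieSubalgebra ℂ (SlC n)) (hb : IsBorelSubalgebra b)
    (A : ℕ) (hA : A ≤ (n + 1).choose 2) :
    (∃ kmin : ℕ, IsLeast (nilpotenceClasses b A) kmin ∧
      IsLeast {k : ℕ | (A : ℤ) ≤ maxDimFormula n k} kmin) ∧
    (∃ kmax : ℕ, IsGreatest (nilpotenceClasses b A) kmax ∧
      (kmax : ℤ) = ⌊(n : ℝ) + 3 / 2
        - 1 / 2 * Real.sqrt (4 * (n : ℝ) ^ 2 + 4 * (n : ℝ) + 9 - 8 * (A : ℝ))⌋) := by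
  rw [hb.nilpotenceClasses_eq]
  exact ⟨exists_isLeast_nilpotenceClasses n A hA, exists_isGreatest_nilpotenceClasses n A hA⟩
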